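/- Let $K$ be an infinite field of characteristic different from $2$ (for instance any field of characteristic $0$), and let $V$ be a $3$-dimensional $K$-vector space with a basis $e_1,e_2,e_3$. Let $ss\mathcal{A}lg_3$ be the vector space of all bilinear maps $\mu:V\times V\to V$ with $\mu(X,Y)=-\mu(Y,X)$ for all $X,Y\in V$. It is $9$-dimensional, and we identify it with the affine space $K^9$ through the structure constants of $\mu$, i.e. the coordinates of $\mu(e_1,e_2)$, $\mu(e_1,e_3)$, $\mu(e_2,e_3)$ in the basis $e_1,e_2,e_3$. For $g\in GL(V)$ put $\mu_g(X,Y)=g^{-1}\mu(g(X),g(Y))$, and let $\mathcal{O}(\mu)=\{\mu_g : g\in GL(V)\}$ be the orbit of $\mu$. The dimension $\dim\mathcal{O}(\mu)$ is the dimension of $\mathcal{O}(\mu)$ as an algebraic variety, that is, the Krull dimension of $K[x_1,\dots,x_9]/I(\mathcal{O}(\mu))$, where $I(\mathcal{O}(\mu))$ is the ideal of all polynomials vanishing on $\mathcal{O}(\mu)$. The algebra $(V,\mu)$ is called rigid if $\mathcal{O}(\mu)$ is Zariski-open in $ss\mathcal{A}lg_3$. Then for every $\mu\in ss\mathcal{A}lg_3$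 we have $\dim\mathcal{O}(\mu)\le 8$, and $\mathcal{O}(\mu)$ is not Zariski-open in $ss\mathcal{A}lg_3$. In particular, no $3$-dimensional skew-symmetric algebra is rigid. -/

import Mathlib

namespace SkewAlg

/-- The space of skew-symmetric algebras on `V`: the bilinear maps `μ : V × V → V`
with `μ(X, Y) = -μ(Y, X)`. -/
def ssAlg (K V : Type*) [Field K] [AddCommGroup V] [Module K V] :
    Submodule K (V →ₗ[K] V →ₗ[K] V) where
  carrier := {μ | ∀ X Y : V, μ X Y = -μ Y X}
  zero_mem' := by intro X Y; simp
  add_mem' := by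
    intro μ ν hμ hν X Y
    simp only [LinearMap.add_apply]
    rw [hμ X Y, hν X Y, neg_add]
  smul_mem' := by
    intro c μ hμ X Y
    simp only [LinearMap.smul_apply]
    rw [hμ X Y, smul_neg]

section

variable {K V : Type*} [Field K] [AddCommGroup V] [Module K V]

/-- The transform of `μ` by `g ∈ GL(V)`: `μ_g(X, Y) = g⁻¹ μ(g X, g Y)`. -/
def act (g : V ≃ₗ[K] V) (μ : ssAlg K V) : ssAlg K V :=
  ⟨(μ.1.compl₁₂ (g : V →ₗ[K] V) (g : V →ₗ[K] V)).compr₂ (g.symm : V →ₗ[K] V), by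
    intro X Y
    simp only [LinearMap.compr₂_apply, LinearMap.compl₁₂_apply, LinearEquiv.coe_coe]
    rw [μ.2 (g X) (g Y), map_neg]⟩

theorem act_apply (g : V ≃ₗ[K] V) (μ : ssAlg K V) (X Y : V) :
    (act g μ).1 X Y = g.symm (μ.1 (g X) (g Y)) := rfl

/-- The orbit `O(μ)` of `μ` under `GL(V)`. -/
def orbit (μ : ssAlg K V) : Set (ssAlg K V) :=
  {ν | ∃ g : V ≃ₗ[K] V, ν = act g μ}

/-- The pairs of indices `(1,2)`, `(1,3)`, `(2,3)` (counted from `0`). -/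
def pair : Fin 3 → Fin 3 × Fin 3 := ![(0, 1), (0, 2), (1, 2)]

/-- The nine structure constants of `μ` in the basis `e`: the entry at `(i, j)` is the
`j`-th coordinate of `μ(e_a, e_b)`, where `(a, b)` is the `i`-th of the pairs
`(1,2)`, `(1,3)`, `(2,3)`. -/
noncomputable def structConst (e : Module.Basis (Fin 3) K V) :
    ssAlg K V →ₗ[K] (Fin 3 × Fin 3 → K) where
  toFun μ p := e.repr (μ.1 (e (pair p.1).1) (e (pair p.1).2)) p.2
  map_add' μ ν := by ext p; simp
  map_smul' c μ := by ext p; simp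

/-- In characteristic different from `2`, the structure constants identify the space of
skew-symmetric algebras with the affine space `K⁹`. -/
theorem structConst_bijective (h2 : (2 : K) ≠ 0) (e : Module.Basis (Fin 3) K V) :
    Function.Bijective (structConst e) := by
  have key : ∀ μ : ssAlg K V, ∀ X : V, μ.1 X X = 0 := by
    intro μ X
    have h := μ.2 X X
    have h' : (2 : K) • μ.1 X X = 0 := by
      rw [two_smul]; nth_rewrite 1 [h]; simp
    exact (smul_eq_zero.mp h').resolve_left h2
  constructor
  · rw [injective_iff_map_eq_zero]
    intro μ hμ
    have hp : ∀ i : Fin 3, μ.1 (e (pair i).1) (e (pair i).2) = 0 := by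
      intro i
      apply e.repr.injective
      ext j
      simpa [structConst] using congrFun hμ (i, j)
    have h01 := hp 0
    have h02 := hp 1
    have h12 := hp 2
    simp only [pair, Matrix.cons_val] at h01 h02 h12
    apply Subtype.ext
    refine e.ext fun i => e.ext fun j => ?_
    have hs := μ.2 (e i) (e j)
    fin_cases i <;> fin_cases j <;> simp_all
  · intro c
    let w : Fin 3 → V := fun i => ∑ j, c (i, j) • e j
    let m : Fin 3 → Fin 3 → V := ![![0, w 0, w 1], ![-w 0, 0, w 2], ![-w 1, -w 2, 0]]
    let μ : V →ₗ[K] V →ₗ[K] V := e.constr K fun i => e.constr K fun j => m i j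
    have hμ : ∀ i j, μ (e i) (e j) = m i j := by
      intro i j; simp [μ]
    have hs : μ = -μ.flip := by
      refine e.ext fun i => e.ext fun j => ?_
      simp only [LinearMap.neg_apply, LinearMap.flip_apply, hμ]
      fin_cases i <;> fin_cases j <;> simp [m]
    refine ⟨⟨μ, fun X Y => by
      have := LinearMap.congr_fun (LinearMap.congr_fun hs X) Y
      simpa using this⟩, ?_⟩
    ext ⟨i, j⟩
    simp only [structConst, LinearMap.coe_mk, AddHom.coe_mk, hμ]
    fin_cases i <;> simp [pair, m, w, Finsupp.single_apply]

end

section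

variable {K : Type*} [Field K] {σ : Type*}

/-- A subset of the affine space `K^σ` is Zariski-open if its complement is the set of
common zeros of an ideal of polynomials. -/
def IsZariskiOpen (U : Set (σ → K)) : Prop :=
  ∃ I : Ideal (MvPolynomial σ K), Uᶜ = MvPolynomial.zeroLocus K I

/-- The dimension of a subset `S` of the affine space `K^σ` as an algebraic variety: the Krull
dimension of the coordinate ring `K[x] / I(S)` of its Zariski closure. -/
noncomputable def varietyDim (S : Set (σ → K)) : WithBot ℕ∞ :=
  ringKrullDim (MvPolynomial σ K ⧸ MvPolynomial.vanishingIdeal K S)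

end

section

variable {K V : Type*} [Field K] [AddCommGroup V] [Module K V]

/-- The dimension of the orbit `O(μ)`, as a subvariety of the affine space of structure
constants. -/
noncomputable def orbitDim (e : Module.Basis (Fin 3) K V) (μ : ssAlg K V) : WithBot ℕ∞ :=
  varietyDim (structConst e '' orbit μ)

/-- `μ` is rigid if its orbit is Zariski-open in the affine space of structure constants. -/
def IsRigid (e : Module.Basis (Fin 3) K V) (μ : ssAlg K V) : Prop :=
  IsZariskiOpen (structConst e '' orbit μ)

end

end SkewAlg

/-! Write the structure constants as a matrix `M` of the map `Λ²V → V`. Since `Λ²V` is `V*` twisted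
by the determinant, `g` acts by `M ↦ d • (H * M * Hᵀ)` with `H = g⁻¹` and `d = det g`. The cubics
`det M` and `axialForm M` are both multiplied by `d`, so their ratio is a rational invariant. Each
orbit therefore lies on a cubic hypersurface `a * det + b * axialForm = 0`, nonzero because the two
cubics are linearly independent. A hypersurface in `K⁹` has dimension at most 8 and, `K` being
infinite, contains no nonempty open set. -/

namespace SkewAlg

/-! ### Two cubic semi-invariants of equal weight -/

section invariants

variable {R : Type*} [CommRing R]

/-- The structure constants as a matrix `Λ²V → V`, where `Λ²V` carries the basis
`e₂ ∧ e₃`, `e₃ ∧ e₁`, `e₁ ∧ e₂`. -/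
def constMatrix (c : Fin 3 × Fin 3 → R) : Matrix (Fin 3) (Fin 3) R :=
  !![c (2, 0), c (2, 1), c (2, 2);
    -c (1, 0), -c (1, 1), -c (1, 2);
    c (0, 0), c (0, 1), c (0, 2)]

/-- The vector dual to the skew part of a `3 × 3` matrix. For `constMatrix` it is the
linear form `X ↦ tr (ad X)`. -/
def axial (M : Matrix (Fin 3) (Fin 3) R) : Fin 3 → R :=
  ![M 2 1 - M 1 2, M 0 2 - M 2 0, M 1 0 - M 0 1]

/-- The value of the quadratic form of `M` at its axial vector. -/
def axialForm (M : Matrix (Fin 3) (Fin 3) R) : R :=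
  axial M ⬝ᵥ M.mulVec (axial M)

/-- Congruence preserves skew parts, and on the skew matrix of a vector it acts through the cofactor
matrix of `H`. -/
theorem axial_smul_conj (d : R) (H M : Matrix (Fin 3) (Fin 3) R) :
    axial (d • (H * M * H.transpose)) = d • H.adjugate.transpose.mulVec (axial M) := by
  ext i
  fin_cases i <;>
  · simp [axial, Matrix.mul_apply, Fin.sum_univ_three, Matrix.adjugate_fin_three,
      Matrix.mulVec, dotProduct]
    ring

theorem axialForm_smul_conj {d : R} {H : Matrix (Fin 3) (Fin 3) R} (hd : d * H.det = 1)
    (M : Matrix (Fin 3) (Fin 3) R) :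
    axialForm (d • (H * M * H.transpose)) = d * axialForm M := by
  have hH : H.transpose.mulVec (H.adjugate.transpose.mulVec (axial M)) = H.det • axial M := by
    rw [Matrix.mulVec_mulVec, ← Matrix.transpose_mul, Matrix.adjugate_mul, Matrix.transpose_smul,
      Matrix.transpose_one, Matrix.smul_mulVec, Matrix.one_mulVec]
  have hv (w : Fin 3 → R) :
      H.adjugate.transpose.mulVec (axial M) ⬝ᵥ H.mulVec w = H.det * (axial M ⬝ᵥ w) := by
    rw [Matrix.dotProduct_mulVec, ← Matrix.mulVec_transpose, hH, smul_dotProduct, smul_eq_mul]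
  rw [axialForm, axial_smul_conj, Matrix.smul_mulVec, ← Matrix.mulVec_mulVec,
    ← Matrix.mulVec_mulVec, Matrix.mulVec_smul, hH, smul_dotProduct, dotProduct_smul,
    Matrix.mulVec_smul, Matrix.mulVec_smul, Matrix.mulVec_smul, Matrix.mulVec_smul,
    dotProduct_smul, dotProduct_smul, hv, axialForm]
  simp only [smul_eq_mul]
  -- With `h = det H`: `d³h² - d = d(dh + 1)(dh - 1)`.
  linear_combination (d * H.det * d + d) * (axial M ⬝ᵥ M.mulVec (axial M)) * hd

theorem det_smul_conj {d : R} {H : Matrix (Fin 3) (Fin 3) R} (hd : d * H.det = 1)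
    (M : Matrix (Fin 3) (Fin 3) R) :
    (d • (H * M * H.transpose)).det = d * M.det := by
  rw [Matrix.det_smul, Matrix.det_mul, Matrix.det_mul, Matrix.det_transpose, Fintype.card_fin]
  linear_combination (d * H.det * d + d) * M.det * hd

theorem map_det_constMatrix {S : Type*} [CommRing S] (φ : R →+* S) (c : Fin 3 × Fin 3 → R) :
    φ (constMatrix c).det = (constMatrix (φ ∘ c)).det := by
  simp [constMatrix, Matrix.det_fin_three]

theorem map_axialForm_constMatrix {S : Type*} [CommRing S] (φ : R →+* S)
    (c : Fin 3 × Fin 3 → R) :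
    φ (axialForm (constMatrix c)) = axialForm (constMatrix (φ ∘ c)) := by
  simp [constMatrix, axialForm, axial, Matrix.mulVec, dotProduct, Fin.sum_univ_three]

end invariants

/-! ### The action on structure constants -/

section orbit

variable {K V : Type*} [Field K] [AddCommGroup V] [Module K V]

theorem apply_self_eq_zero (h2 : (2 : K) ≠ 0) (μ : ssAlg K V) (X : V) : μ.1 X X = 0 := by
  have h : μ.1 X X + μ.1 X X = 0 := eq_neg_iff_add_eq_zero.mp (μ.2 X X)
  rw [← two_smul K] at h
  exact (smul_eq_zero.mp h).resolve_left h2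

/-- The action of `g` on `Λ²V` is given by its `2 × 2` minors, which in the chosen basis are the
entries of the adjugate. -/
theorem constMatrix_act (h2 : (2 : K) ≠ 0) (e : Module.Basis (Fin 3) K V) (μ : ssAlg K V)
    (g : V ≃ₗ[K] V) :
    constMatrix (structConst e (act g μ)) =
      (LinearMap.toMatrix e e (g : V →ₗ[K] V)).adjugate * constMatrix (structConst e μ) *
        (LinearMap.toMatrix e e (g.symm : V →ₗ[K] V)).transpose := by
  set G := LinearMap.toMatrix e e (g : V →ₗ[K] V) with hG
  set H := LinearMap.toMatrix e e (g.symm : V →ₗ[K] V) with hH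
  have hg (a : Fin 3) : g (e a) = G 0 a • e 0 + G 1 a • e 1 + G 2 a • e 2 := by
    rw [← e.sum_repr (g (e a)), Fin.sum_univ_three]
    simp [hG, LinearMap.toMatrix_apply]
  have hs (v : V) (j : Fin 3) :
      e.repr (g.symm v) j = H j 0 * e.repr v 0 + H j 1 * e.repr v 1 + H j 2 * e.repr v 2 := by
    have := congrFun (LinearMap.toMatrix_mulVec_repr e e (g.symm : V →ₗ[K] V) v) j
    simpa [Matrix.mulVec, dotProduct, Fin.sum_univ_three] using this.symm
  have hμ (a b : Fin 3) : μ.1 (g (e a)) (g (e b)) =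
      (G 0 a * G 1 b - G 1 a * G 0 b) • μ.1 (e 0) (e 1) +
      (G 0 a * G 2 b - G 2 a * G 0 b) • μ.1 (e 0) (e 2) +
      (G 1 a * G 2 b - G 2 a * G 1 b) • μ.1 (e 1) (e 2) := by
    rw [hg, hg]
    simp only [map_add, map_smul, LinearMap.add_apply, LinearMap.smul_apply,
      apply_self_eq_zero h2, μ.2 (e 1) (e 0), μ.2 (e 2) (e 0), μ.2 (e 2) (e 1)]
    module
  have hc (i j : Fin 3) : structConst e (act g μ) (i, j) =
      e.repr (g.symm (μ.1 (g (e (pair i).1)) (g (e (pair i).2)))) j := rfl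
  have hc' (i j : Fin 3) : structConst e μ (i, j) =
      e.repr (μ.1 (e (pair i).1) (e (pair i).2)) j := rfl
  ext i j
  fin_cases i <;> fin_cases j <;>
  · simp [constMatrix, hc, hc', hs, hμ, Matrix.mul_apply, Fin.sum_univ_three,
      Matrix.adjugate_fin_three, pair]
    ring

theorem exists_constMatrix_act_eq (h2 : (2 : K) ≠ 0) (e : Module.Basis (Fin 3) K V)
    (μ : ssAlg K V) (g : V ≃ₗ[K] V) :
    ∃ (d : K) (H : Matrix (Fin 3) (Fin 3) K), d * H.det = 1 ∧
      constMatrix (structConst e (act g μ)) =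
        d • (H * constMatrix (structConst e μ) * H.transpose) := by
  have hGH : LinearMap.toMatrix e e (g : V →ₗ[K] V) *
      LinearMap.toMatrix e e (g.symm : V →ₗ[K] V) = 1 := by
    rw [← LinearMap.toMatrix_comp, LinearEquiv.comp_symm, LinearMap.toMatrix_id]
  refine ⟨(LinearMap.toMatrix e e (g : V →ₗ[K] V)).det,
    LinearMap.toMatrix e e (g.symm : V →ₗ[K] V), ?_, ?_⟩
  · rw [← Matrix.det_mul, hGH, Matrix.det_one]
  · have hadj : (LinearMap.toMatrix e e (g : V →ₗ[K] V)).adjugate =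
        (LinearMap.toMatrix e e (g : V →ₗ[K] V)).det •
          LinearMap.toMatrix e e (g.symm : V →ₗ[K] V) := by
      rw [← Matrix.mul_one (Matrix.adjugate _), ← hGH, ← Matrix.mul_assoc, Matrix.adjugate_mul,
        Matrix.smul_mul, Matrix.one_mul]
    rw [constMatrix_act h2, hadj, Matrix.smul_mul, Matrix.smul_mul]

theorem exists_combination_ne_zero (a b : K) (hab : a ≠ 0 ∨ b ≠ 0) :
    MvPolynomial.C a * (constMatrix (MvPolynomial.X (R := K))).det +
      MvPolynomial.C b * axialForm (constMatrix (MvPolynomial.X (R := K))) ≠ 0 := by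
  intro h
  have key (c : Fin 3 × Fin 3 → K) :
      a * (constMatrix c).det + b * axialForm (constMatrix c) = 0 := by
    have hX : (MvPolynomial.eval c : MvPolynomial (Fin 3 × Fin 3) K →+* K) ∘
        MvPolynomial.X = c := by ext; simp
    have := congrArg (MvPolynomial.eval c) h
    simpa [map_det_constMatrix, map_axialForm_constMatrix, hX] using this
  -- Here `constMatrix` is the identity, with determinant 1 and axial vector 0, so `a = 0`. At the
  -- second point the determinant is 0 and `axialForm` is 1, so `b = 0`.
  have hone := key fun p => !![0, 0, 1; 0, -1, 0; 1, 0, 0] p.1 p.2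
  have htwo := key fun p => !![0, 0, 0; 0, 0, -1; 1, 0, 0] p.1 p.2
  simp [constMatrix, axialForm, axial, Matrix.det_fin_three, Matrix.vecHead] at hone htwo
  simp_all

/-- Every orbit lies on a hypersurface. -/
theorem exists_ne_zero_forall_orbit_eval_eq_zero (h2 : (2 : K) ≠ 0)
    (e : Module.Basis (Fin 3) K V) (μ : ssAlg K V) :
    ∃ F : MvPolynomial (Fin 3 × Fin 3) K, F ≠ 0 ∧
      ∀ x ∈ structConst e '' orbit μ, MvPolynomial.eval x F = 0 := by
  obtain ⟨a, b, hab, h0⟩ : ∃ a b : K, (a ≠ 0 ∨ b ≠ 0) ∧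
      a * (constMatrix (structConst e μ)).det +
        b * axialForm (constMatrix (structConst e μ)) = 0 := by
    by_cases h : (constMatrix (structConst e μ)).det = 0
    · exact ⟨1, 0, by simp, by simp [h]⟩
    · exact ⟨axialForm (constMatrix (structConst e μ)), -(constMatrix (structConst e μ)).det,
        by simp [h], by ring⟩
  refine ⟨_, exists_combination_ne_zero a b hab, ?_⟩
  rintro _ ⟨_, ⟨g, rfl⟩, rfl⟩
  obtain ⟨d, H, hd, hM⟩ := exists_constMatrix_act_eq h2 e μ g
  have hX : (MvPolynomial.eval (structConst e (act g μ)) :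
      MvPolynomial (Fin 3 × Fin 3) K →+* K) ∘ MvPolynomial.X = structConst e (act g μ) := by
    ext; simp
  rw [map_add, map_mul, map_mul, MvPolynomial.eval_C, MvPolynomial.eval_C, map_det_constMatrix,
    map_axialForm_constMatrix, hX, hM, det_smul_conj hd, axialForm_smul_conj hd]
  linear_combination d * h0

end orbit

/-! ### Subsets of hypersurfaces in affine space -/

section affine

variable {K : Type*} [Field K] {σ : Type*}

theorem varietyDim_add_one_le [Finite σ] {S : Set (σ → K)} {F : MvPolynomial σ K} (hF : F ≠ 0)
    (hS : ∀ x ∈ S, MvPolynomial.eval x F = 0) : varietyDim S + 1 ≤ Nat.card σ := by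
  have hmem : F ∈ MvPolynomial.vanishingIdeal K S := by
    rw [MvPolynomial.mem_vanishingIdeal_iff]
    intro x hx
    simpa [MvPolynomial.aeval_eq_eval] using hS x hx
  have hle : Ideal.span {F} ≤ MvPolynomial.vanishingIdeal K S := by
    simpa [Ideal.span_le] using hmem
  calc varietyDim S + 1 ≤ ringKrullDim (MvPolynomial σ K ⧸ Ideal.span {F}) + 1 := by
        gcongr
        exact ringKrullDim_le_of_surjective _ (Ideal.Quotient.factor_surjective hle)
    _ ≤ ringKrullDim (MvPolynomial σ K) :=
        ringKrullDim_quotient_succ_le_of_nonZeroDivisor (mem_nonZeroDivisors_of_ne_zero hF)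
    _ = Nat.card σ := by
        rw [MvPolynomial.ringKrullDim_of_isNoetherianRing, ringKrullDim_eq_zero_of_field, zero_add]

theorem not_isZariskiOpen [Infinite K] {U : Set (σ → K)} (hU : U.Nonempty)
    {F : MvPolynomial σ K} (hF : F ≠ 0) (hS : ∀ x ∈ U, MvPolynomial.eval x F = 0) :
    ¬ IsZariskiOpen U := by
  rintro ⟨I, hI⟩
  obtain ⟨x, hx⟩ := hU
  have hx' : x ∉ MvPolynomial.zeroLocus K I := by
    rw [← hI]; simpa using hx
  rw [MvPolynomial.mem_zeroLocus_iff] at hx'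
  push Not at hx'
  obtain ⟨f, hfI, hfx⟩ := hx'
  have hf : f ≠ 0 := by rintro rfl; simp at hfx
  -- `F` vanishes on `U` and `f` off `U`, so `f * F` vanishes everywhere, hence is zero over an
  -- infinite field.
  refine mul_ne_zero hf hF (MvPolynomial.funext fun y => ?_)
  rw [map_mul, map_zero]
  by_cases hy : y ∈ U
  · rw [hS y hy, mul_zero]
  · have hy' : y ∈ MvPolynomial.zeroLocus K I := hI ▸ hy
    have := MvPolynomial.mem_zeroLocus_iff.mp hy' f hfI
    rw [MvPolynomial.aeval_eq_eval] at this
    rw [show MvPolynomial.eval y f = 0 from this, zero_mul]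

end affine

end SkewAlg

theorem mainTheorem8 {K V : Type*} [Field K] [Infinite K] (h2 : (2 : K) ≠ 0)
    [AddCommGroup V] [Module K V] (e : Module.Basis (Fin 3) K V) (μ : SkewAlg.ssAlg K V) :
    SkewAlg.orbitDim e μ ≤ 8 ∧ ¬ SkewAlg.IsRigid e μ := by
  obtain ⟨F, hF, hS⟩ := SkewAlg.exists_ne_zero_forall_orbit_eval_eq_zero h2 e μ
  refine ⟨?_, SkewAlg.not_isZariskiOpen ⟨_, μ, ⟨LinearEquiv.refl K V, rfl⟩, rfl⟩ hF hS⟩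
  have h := SkewAlg.varietyDim_add_one_le hF hS
  rw [show ((Nat.card (Fin 3 × Fin 3) : ℕ) : WithBot ℕ∞) = 8 + 1 by
    simp [Nat.card_eq_fintype_card]; norm_num] at h
  exact ENat.WithBot.add_le_add_one_right_iff.mp h
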